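/- For an integer $l\ge 0$ let \[ \xi_l=\int_{[0,1]^l}\frac{dx_1\cdots dx_l}{(1-x_1x_2)(1-x_2x_3)\cdots(1-x_{l-1}x_l)}, \] where an empty product is $1$; in particular $\xi_0=\xi_1=1$. Let $l=2m$ be even, with $m\ge 0$ an integer. Then the integrals $\xi_0,\dots,\xi_{l+1}$ converge absolutely, and \[ \xi_{l+1}=\sum_{h=0}^{m}\xi_{2h}\,\xi_{l-2h}. \] -/

import Mathlib

open MeasureTheory

/-- The integrand `1 / ((1 - x₁ x₂) (1 - x₂ x₃) ⋯ (1 - x_{l-1} x_l))` in the `l` variables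
`x₁, …, x_l`, here indexed from `0`. For `l = 0` and `l = 1` the product is empty. -/
noncomputable def xiIntegrand (l : ℕ) (x : Fin l → ℝ) : ℝ :=
  1 / ∏ j : Fin (l - 1), (1 - x ⟨j, by omega⟩ * x ⟨j + 1, by omega⟩)

/-- The unit cube `[0,1]^l`. -/
def unitCube (l : ℕ) : Set (Fin l → ℝ) :=
  Set.univ.pi fun _ => Set.Icc (0 : ℝ) 1

/-- `ξ_l`, the integral of `1 / ((1 - x₁ x₂) ⋯ (1 - x_{l-1} x_l))` over `[0,1]^l` against Lebesgue
measure. For `l = 0` this is the integral of `1` over a point of mass `1`. -/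
noncomputable def xi (l : ℕ) : ℝ :=
  ∫ x in unitCube l, xiIntegrand l x

/-! Under x = tanh(u/2) the kernel 1/(1 - xy) on [0,1] becomes, up to conjugation by 2 cosh(u/2),
the convolution kernel k = `sechKernel` on the half-line (`chain_unit_eq_chain_sech`). Hence ξ_l is
twice the integral of k(0 - u₁) k(u₁ - u₂) ⋯ k(u_l - 0) over all u_i > 0.

This cyclic product is invariant under rotation and translation, and u_i > 0 says that 0 is the
strict minimum of the l + 1 points. Each point is the minimum equally often, so the half-line
integral is 1/(l + 1) of the whole-line one (`chain_volume_eq`), which is a convolution power of k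
at 0.

By a beta integral, the Fourier transform of k is k again up to scaling. The convolution power at 0
is therefore a constant times ∫ k^(l+1), and integration by parts links l + 2 to l
(`sechFourier_add_two`).

It follows that ξ_{2h}/π^{2h} are the coefficients of arcsin x / x in the variable x². The
convolution sum is a coefficient of the square of this series, whose differential equation yields
the recursion of the odd-index values (`antidiagonal_sum_arcsin`).

Working in `ℝ≥0∞` makes Tonelli available unconditionally; absolute convergence follows from the
finite final value. -/

open MeasureTheory
open scoped ENNReal

/-! ### Iterated integrals and the integrand on the cube -/

/-- The iterated integral `∫ k a x₁ ∫ k x₁ x₂ ⋯ ∫ k x_{l-1} x_l e(x_l)` against `μ`. -/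
noncomputable def chain (μ : Measure ℝ) (k : ℝ → ℝ → ℝ≥0∞) (e : ℝ → ℝ≥0∞) : ℕ → ℝ → ℝ≥0∞
  | 0, a => e a
  | l + 1, a => ∫⁻ b, k a b * chain μ k e l b ∂μ

/-- The integrand of which `chain` is the iterated integral. -/
noncomputable def chainProd (k : ℝ → ℝ → ℝ≥0∞) (e : ℝ → ℝ≥0∞) (l : ℕ) (a : ℝ)
    (v : Fin l → ℝ) : ℝ≥0∞ :=
  (∏ i : Fin l, k ((Fin.cons a v : Fin (l + 1) → ℝ) i.castSucc) (v i)) *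
    e ((Fin.cons a v : Fin (l + 1) → ℝ) (Fin.last l))

theorem measurable_chainProd {k : ℝ → ℝ → ℝ≥0∞} (hk : Measurable (Function.uncurry k))
    {e : ℝ → ℝ≥0∞} (he : Measurable e) (l : ℕ) (a : ℝ) : Measurable (chainProd k e l a) := by
  have hc : Measurable fun v : Fin l → ℝ => (Fin.cons a v : Fin (l + 1) → ℝ) := by
    refine measurable_pi_iff.2 fun i => ?_
    refine Fin.cases ?_ (fun j => ?_) i
    · simp
    · simpa using measurable_pi_apply j
  unfold chainProd
  refine Measurable.mul (Finset.measurable_prod _ fun i _ => ?_)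
    (he.comp ((measurable_pi_apply _).comp hc))
  exact hk.comp (((measurable_pi_apply i.castSucc).comp hc).prodMk (measurable_pi_apply i))

theorem chainProd_cons (k : ℝ → ℝ → ℝ≥0∞) (e : ℝ → ℝ≥0∞) (l : ℕ) (a b : ℝ) (v : Fin l → ℝ) :
    chainProd k e (l + 1) a (Fin.cons b v : Fin (l + 1) → ℝ) = k a b * chainProd k e l b v := by
  unfold chainProd
  rw [Fin.prod_univ_succ, mul_assoc]
  congr 1

theorem lintegral_pi_succ (μ : Measure ℝ) [SigmaFinite μ] (l : ℕ)
    {F : (Fin (l + 1) → ℝ) → ℝ≥0∞} (hF : Measurable F) :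
    ∫⁻ u, F u ∂Measure.pi (fun _ => μ) =
      ∫⁻ b, ∫⁻ v, F (Fin.cons b v : Fin (l + 1) → ℝ) ∂Measure.pi (fun _ : Fin l => μ) ∂μ := by
  have h := (measurePreserving_piFinSuccAbove (fun _ : Fin (l + 1) => μ) 0).symm
  have hm := hF.comp h.measurable
  rw [← h.lintegral_comp hF]
  refine (lintegral_prod _ hm.aemeasurable).trans ?_
  simp [MeasurableEquiv.piFinSuccAbove_symm_apply, Fin.insertNthEquiv]

theorem lintegral_chainProd (μ : Measure ℝ) [SigmaFinite μ] {k : ℝ → ℝ → ℝ≥0∞}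
    (hk : Measurable (Function.uncurry k)) {e : ℝ → ℝ≥0∞} (he : Measurable e) (l : ℕ) (a : ℝ) :
    ∫⁻ v, chainProd k e l a v ∂Measure.pi (fun _ => μ) = chain μ k e l a := by
  induction l generalizing a with
  | zero =>
    rw [Measure.pi_of_empty (fun _ : Fin 0 => μ) 0, lintegral_dirac]
    simp [chainProd, chain]
  | succ l ih =>
    rw [lintegral_pi_succ μ l (measurable_chainProd hk he _ a)]
    simp only [chainProd_cons, chain]
    congr 1 with b
    rw [lintegral_const_mul _ (measurable_chainProd hk he _ b), ih]

theorem volume_restrict_pi (l : ℕ) (s : Set ℝ) :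
    (volume : Measure (Fin l → ℝ)).restrict (Set.univ.pi fun _ => s) =
      Measure.pi fun _ => (volume : Measure ℝ).restrict s := by
  rw [volume_pi, Measure.restrict_pi_pi]

theorem measurableSet_unitCube (l : ℕ) : MeasurableSet (unitCube l) :=
  MeasurableSet.univ_pi fun _ => measurableSet_Icc

theorem xiIntegrand_nonneg (l : ℕ) {x : Fin l → ℝ} (hx : x ∈ unitCube l) :
    0 ≤ xiIntegrand l x := by
  refine one_div_nonneg.2 (Finset.prod_nonneg fun j _ => ?_)
  have h1 := hx ⟨j, by omega⟩ trivial
  have h2 := hx ⟨j + 1, by omega⟩ trivial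
  have := mul_le_one₀ h1.2 h2.1 h2.2
  linarith

theorem measurable_xiIntegrand (l : ℕ) : Measurable (xiIntegrand l) := by
  unfold xiIntegrand
  fun_prop

/-- Starting the chain at 0 makes its first factor 1/(1 - 0 · x₁) = 1, which reconciles l kernel
factors with the l - 1 factors of the integrand. -/
theorem ofReal_xiIntegrand (l : ℕ) {x : Fin l → ℝ} (hx : x ∈ unitCube l) :
    ENNReal.ofReal (xiIntegrand l x) =
      chainProd (fun x y => ENNReal.ofReal (1 / (1 - x * y))) (fun _ => 1) l 0 x := by
  cases l with
  | zero => simp [xiIntegrand, chainProd]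
  | succ l =>
    unfold chainProd xiIntegrand
    rw [Fin.prod_univ_succ, mul_one, ← ENNReal.ofReal_prod_of_nonneg, one_div,
      ← Finset.prod_inv_distrib]
    · simp only [Fin.castSucc_zero, Fin.cons_zero, zero_mul, sub_zero, div_one, ENNReal.ofReal_one,
        one_mul, one_div]
      rfl
    · intro j _
      have h1 := hx j.castSucc trivial
      have h2 := hx j.succ trivial
      have := mul_le_one₀ h1.2 h2.1 h2.2
      refine one_div_nonneg.2 ?_
      change 0 ≤ 1 - x j.castSucc * x j.succ
      linarith

theorem lintegral_xiIntegrand (l : ℕ) :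
    ∫⁻ x in unitCube l, ENNReal.ofReal (xiIntegrand l x) =
      chain (volume.restrict (Set.Icc 0 1)) (fun x y => ENNReal.ofReal (1 / (1 - x * y)))
        (fun _ => 1) l 0 := by
  rw [setLIntegral_congr_fun (measurableSet_unitCube l) fun x hx => ofReal_xiIntegrand l hx,
    unitCube, volume_restrict_pi, lintegral_chainProd]
  · unfold Function.uncurry
    fun_prop
  · fun_prop

/-! ### The substitution x = tanh(u/2) -/

/-- The convolution kernel `1 / (2 cosh (u / 2))`. -/
noncomputable def sechKernel (u : ℝ) : ℝ := 1 / (2 * Real.cosh (u / 2))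

theorem continuous_sechKernel : Continuous sechKernel := by
  unfold sechKernel
  refine Continuous.div (by fun_prop) (by fun_prop) fun x => ?_
  have := Real.cosh_pos (x / 2)
  positivity

theorem sechKernel_pos (u : ℝ) : 0 < sechKernel u := by
  have := Real.cosh_pos (u / 2)
  unfold sechKernel
  positivity

theorem sechKernel_neg (u : ℝ) : sechKernel (-u) = sechKernel u := by
  simp [sechKernel, neg_div]

theorem hasDerivAt_tanh_half (u : ℝ) :
    HasDerivAt (fun u : ℝ => Real.tanh (u / 2)) (1 / (2 * Real.cosh (u / 2) ^ 2)) u := by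
  have hc := (Real.cosh_pos (u / 2)).ne'
  have h1 : HasDerivAt (fun u : ℝ => u / 2) (1 / 2) u := (hasDerivAt_id u).div_const 2
  have h := h1.sinh.div h1.cosh hc
  have e : (fun u : ℝ => Real.tanh (u / 2)) =
      (fun u : ℝ => Real.sinh (u / 2)) / fun u : ℝ => Real.cosh (u / 2) := by
    ext u; simp [Real.tanh_eq_sinh_div_cosh]
  rw [e]
  refine h.congr_deriv ?_
  field_simp
  linear_combination Real.cosh_sq_sub_sinh_sq (u / 2)

theorem tanh_half_image : (fun u : ℝ => Real.tanh (u / 2)) '' Set.Ioi 0 = Set.Ioo 0 1 := by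
  ext y
  constructor
  · rintro ⟨u, hu, rfl⟩
    refine ⟨?_, Real.tanh_lt_one _⟩
    beta_reduce
    rw [Real.tanh_eq_sinh_div_cosh]
    exact div_pos (Real.sinh_pos_iff.2 (half_pos hu)) (Real.cosh_pos _)
  · intro hy
    refine ⟨2 * Real.artanh y, by simpa using Real.artanh_pos hy, ?_⟩
    simpa using Real.tanh_artanh ⟨by linarith [hy.1], hy.2⟩

theorem one_sub_tanh_half_mul (a b : ℝ) :
    1 - Real.tanh (a / 2) * Real.tanh (b / 2) =
      Real.cosh ((a - b) / 2) / (Real.cosh (a / 2) * Real.cosh (b / 2)) := by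
  have ha := (Real.cosh_pos (a / 2)).ne'
  have hb := (Real.cosh_pos (b / 2)).ne'
  rw [sub_div, Real.cosh_sub, Real.tanh_eq_sinh_div_cosh, Real.tanh_eq_sinh_div_cosh]
  field_simp

/-- In the inductive step, the cosh(b/2) from `one_sub_tanh_half_mul` and the 2 cosh(b/2) from the
induction hypothesis cancel the Jacobian 1/(2 cosh²(b/2)). -/
theorem chain_unit_eq_chain_sech (l : ℕ) (a : ℝ) :
    chain (volume.restrict (Set.Icc 0 1)) (fun x y => ENNReal.ofReal (1 / (1 - x * y)))
        (fun _ => 1) l (Real.tanh (a / 2)) =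
      ENNReal.ofReal (2 * Real.cosh (a / 2)) *
        chain (volume.restrict (Set.Ioi 0)) (fun x y => ENNReal.ofReal (sechKernel (x - y)))
          (fun x => ENNReal.ofReal (sechKernel x)) l a := by
  have hc := fun x : ℝ => Real.cosh_pos x
  have hI : (volume : Measure ℝ).restrict (Set.Icc 0 1) =
      volume.restrict ((fun u : ℝ => Real.tanh (u / 2)) '' Set.Ioi 0) := by
    rw [tanh_half_image, Measure.restrict_congr_set Ioo_ae_eq_Icc]
  rw [hI]
  induction l generalizing a with
  | zero =>
    have := hc (a / 2)
    rw [chain, chain, ← ENNReal.ofReal_mul (by positivity), sechKernel]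
    field_simp
    simp
  | succ l ih =>
    rw [chain, chain, ← lintegral_const_mul' _ _ ENNReal.ofReal_ne_top,
      lintegral_image_eq_lintegral_abs_deriv_mul
        measurableSet_Ioi (fun u _ => (hasDerivAt_tanh_half u).hasDerivWithinAt)]
    · congr 1 with b
      rw [ih, ← mul_assoc, ← mul_assoc, ← mul_assoc]
      congr 1
      have h1 := hc (a / 2)
      have h2 := hc (b / 2)
      have h3 := hc ((a - b) / 2)
      rw [one_sub_tanh_half_mul, ← ENNReal.ofReal_mul (by positivity),
        ← ENNReal.ofReal_mul (by positivity), ← ENNReal.ofReal_mul (by positivity),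
        abs_of_pos (by positivity), sechKernel]
      congr 1
      field_simp
    · intro x _ y _ h
      have := Real.tanh_injective h
      linarith

theorem lintegral_xiIntegrand_eq_chain_sech (l : ℕ) :
    ∫⁻ x in unitCube l, ENNReal.ofReal (xiIntegrand l x) =
      2 * chain (volume.restrict (Set.Ioi 0)) (fun x y => ENNReal.ofReal (sechKernel (x - y)))
          (fun x => ENNReal.ofReal (sechKernel x)) l 0 := by
  have h := chain_unit_eq_chain_sech l 0
  simp only [zero_div, Real.tanh_zero, Real.cosh_zero, mul_one, ENNReal.ofReal_ofNat] at h
  rw [lintegral_xiIntegrand, h]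

/-! ### Cyclic products and the position of the minimum -/

/-- The cyclic product `k(u₀ - u₁) k(u₁ - u₂) ⋯ k(u_l - u₀)`. -/
noncomputable def cyclicProd (k : ℝ → ℝ≥0∞) (l : ℕ) (u : Fin (l + 1) → ℝ) : ℝ≥0∞ :=
  ∏ i, k (u i - u (i + 1))

/-- `u j` is the strict minimum of `u`. -/
def IsStrictArgmin {l : ℕ} (u : Fin (l + 1) → ℝ) (j : Fin (l + 1)) : Prop :=
  ∀ i, i ≠ j → u j < u i

theorem measurable_cyclicProd {k : ℝ → ℝ≥0∞} (hk : Measurable k) (l : ℕ) :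
    Measurable (cyclicProd k l) := by
  unfold cyclicProd
  fun_prop

theorem cyclicProd_cons (k : ℝ → ℝ≥0∞) (l : ℕ) (v : Fin l → ℝ) :
    cyclicProd k l (Fin.cons 0 v : Fin (l + 1) → ℝ) =
      chainProd (fun x y => k (x - y)) k l 0 v := by
  unfold cyclicProd chainProd
  rw [Fin.prod_univ_castSucc]
  simp [Fin.coeSucc_eq_succ]

theorem cyclicProd_add (k : ℝ → ℝ≥0∞) (l : ℕ) (u : Fin (l + 1) → ℝ) (a : ℝ) :
    cyclicProd k l (fun i => u i + a) = cyclicProd k l u := by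
  simp [cyclicProd]

theorem cyclicProd_rotate (k : ℝ → ℝ≥0∞) (l : ℕ) (u : Fin (l + 1) → ℝ) (j : Fin (l + 1)) :
    cyclicProd k l (fun i => u (i + j)) = cyclicProd k l u := by
  unfold cyclicProd
  rw [← Equiv.prod_comp (Equiv.addRight j) fun i => k (u i - u (i + 1))]
  simp [add_right_comm]

theorem isStrictArgmin_rotate {l : ℕ} (u : Fin (l + 1) → ℝ) (j : Fin (l + 1)) :
    IsStrictArgmin (fun i => u (i + j)) 0 ↔ IsStrictArgmin u j := by
  constructor
  · intro h i hi
    simpa using h (i - j) (sub_ne_zero.2 hi)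
  · intro h i hi
    simpa using h (i + j) (by simpa using hi)

theorem isStrictArgmin_add {l : ℕ} (u : Fin (l + 1) → ℝ) (j : Fin (l + 1)) (a : ℝ) :
    IsStrictArgmin (fun i => u i + a) j ↔ IsStrictArgmin u j := by
  simp [IsStrictArgmin]

theorem measurableSet_isStrictArgmin {l : ℕ} (j : Fin (l + 1)) :
    MeasurableSet {u : Fin (l + 1) → ℝ | IsStrictArgmin u j} := by
  simp only [IsStrictArgmin, Set.ofPred_forall]
  exact MeasurableSet.iInter fun i => MeasurableSet.iInter fun _ =>
    measurableSet_lt (measurable_pi_apply j) (measurable_pi_apply i)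

/-- The configurations with strict minimum at `j`, that minimum lying in `(0, 1]`. -/
def argminSet (l : ℕ) (j : Fin (l + 1)) : Set (Fin (l + 1) → ℝ) :=
  {u | IsStrictArgmin u j} ∩ {u | u j ∈ Set.Ioc 0 1}

theorem measurableSet_argminSet (l : ℕ) (j : Fin (l + 1)) : MeasurableSet (argminSet l j) :=
  (measurableSet_isStrictArgmin j).inter (measurable_pi_apply j measurableSet_Ioc)

theorem lintegral_argminSet_rotate {k : ℝ → ℝ≥0∞} (hk : Measurable k) (l : ℕ)
    (j : Fin (l + 1)) :
    ∫⁻ u in argminSet l j, cyclicProd k l u = ∫⁻ u in argminSet l 0, cyclicProd k l u := by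
  have h := volume_measurePreserving_piCongrLeft (fun _ : Fin (l + 1) => ℝ)
    (Equiv.addRight j).symm
  have e : ∀ u : Fin (l + 1) → ℝ,
      MeasurableEquiv.piCongrLeft (fun _ => ℝ) (Equiv.addRight j).symm u =
        fun i => u (i + j) := by
    intro u
    ext i
    obtain ⟨i, rfl⟩ := (Equiv.addRight j).symm.surjective i
    rw [MeasurableEquiv.coe_piCongrLeft, Equiv.piCongrLeft_apply_apply]
    simp
  rw [← lintegral_indicator (measurableSet_argminSet l j),
    ← lintegral_indicator (measurableSet_argminSet l 0),
    ← h.lintegral_comp ((measurable_cyclicProd hk l).indicator (measurableSet_argminSet l 0))]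
  congr 1 with u
  rw [e]
  have hm : (fun i => u (i + j)) ∈ argminSet l 0 ↔ u ∈ argminSet l j := by
    simp [argminSet, isStrictArgmin_rotate]
  by_cases hu : u ∈ argminSet l j
  · rw [Set.indicator_of_mem hu, Set.indicator_of_mem (hm.2 hu), cyclicProd_rotate]
  · rw [Set.indicator_of_notMem hu, Set.indicator_of_notMem (hm.not.2 hu)]

theorem measurable_finCons (l : ℕ) :
    Measurable fun p : ℝ × (Fin l → ℝ) => (Fin.cons p.1 p.2 : Fin (l + 1) → ℝ) := by
  refine measurable_pi_iff.2 fun i => ?_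
  refine Fin.cases ?_ (fun j => ?_) i
  · simpa using measurable_fst
  · simp only [Fin.cons_succ]
    fun_prop

/-- Each translation class has infinite measure in the direction of translation. Confining the
minimum to (0, 1] normalises this in a rotation-invariant way: for a fixed shape the admissible
translations form an interval of length 1. -/
theorem lintegral_argminSet {k : ℝ → ℝ≥0∞} (hk : Measurable k) (l : ℕ) (j : Fin (l + 1)) :
    ∫⁻ u in argminSet l j, cyclicProd k l u =
      ∫⁻ v, {u | IsStrictArgmin u j}.indicator (cyclicProd k l)
        (Fin.cons 0 v : Fin (l + 1) → ℝ) := by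
  have hS := measurableSet_isStrictArgmin j
  have hG := measurable_cyclicProd hk l
  have hF := hG.indicator (measurableSet_argminSet l j)
  have hc := measurable_finCons l
  rw [← lintegral_indicator (measurableSet_argminSet l j), volume_pi, lintegral_pi_succ _ _ hF]
  simp only [← volume_pi]
  -- Once the other coordinates are measured relative to the first one, a, the integrand separates
  -- into a function of the shape v and the indicator of a unit interval in a.
  have key : ∀ (a : ℝ) (v : Fin l → ℝ),
      (argminSet l j).indicator (cyclicProd k l)
          (Fin.cons a (v + fun _ => a) : Fin (l + 1) → ℝ) =
        {u | IsStrictArgmin u j}.indicator (cyclicProd k l) (Fin.cons 0 v : Fin (l + 1) → ℝ) *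
          (Set.Ioc (-(Fin.cons 0 v : Fin (l + 1) → ℝ) j)
            (1 - (Fin.cons 0 v : Fin (l + 1) → ℝ) j)).indicator (fun _ => 1) a := by
    intro a v
    have e : (Fin.cons a (v + fun _ => a) : Fin (l + 1) → ℝ) =
        fun i => (Fin.cons 0 v : Fin (l + 1) → ℝ) i + a := by
      ext i
      refine Fin.cases ?_ (fun i => ?_) i <;> simp
    rw [e]
    generalize (Fin.cons 0 v : Fin (l + 1) → ℝ) = c
    have hm : a ∈ Set.Ioc (-c j) (1 - c j) ↔ c j + a ∈ Set.Ioc (0 : ℝ) 1 := by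
      simp only [Set.mem_Ioc]
      constructor <;> rintro ⟨h1, h2⟩ <;> constructor <;> linarith
    by_cases h1 : IsStrictArgmin c j <;> by_cases h2 : c j + a ∈ Set.Ioc (0 : ℝ) 1 <;>
      simp only [Set.indicator, argminSet, Set.mem_inter_iff, Set.mem_ofPred_eq, hm, h1, h2,
        isStrictArgmin_add, cyclicProd_add, and_true, and_false, if_true, if_false, mul_one,
        mul_zero]
  have hmeas : Measurable (Function.uncurry fun (a : ℝ) (v : Fin l → ℝ) =>
      (argminSet l j).indicator (cyclicProd k l)
          (Fin.cons a (v + fun _ => a) : Fin (l + 1) → ℝ)) := by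
    have hg : Measurable fun p : ℝ × (Fin l → ℝ) => (p.1, p.2 + fun _ => p.1) := by fun_prop
    exact hF.comp (hc.comp hg)
  calc _ = ∫⁻ a, ∫⁻ v : Fin l → ℝ, (argminSet l j).indicator (cyclicProd k l)
          (Fin.cons a (v + fun _ => a) : Fin (l + 1) → ℝ) := by
        congr 1 with a
        exact (lintegral_add_right_eq_self (fun v : Fin l → ℝ =>
          (argminSet l j).indicator (cyclicProd k l) (Fin.cons a v : Fin (l + 1) → ℝ)) _).symm
    _ = ∫⁻ v : Fin l → ℝ, ∫⁻ a, (argminSet l j).indicator (cyclicProd k l)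
          (Fin.cons a (v + fun _ => a) : Fin (l + 1) → ℝ) :=
        lintegral_lintegral_swap hmeas.aemeasurable
    _ = _ := by
        congr 1 with v
        simp only [key]
        rw [lintegral_const_mul _ (measurable_const.indicator measurableSet_Ioc),
          lintegral_indicator_const measurableSet_Ioc, Real.volume_Ioc]
        simp

theorem lintegral_argminSet_zero {k : ℝ → ℝ≥0∞} (hk : Measurable k) (l : ℕ) :
    ∫⁻ u in argminSet l 0, cyclicProd k l u =
      chain (volume.restrict (Set.Ioi 0)) (fun x y => k (x - y)) k l 0 := by
  rw [lintegral_argminSet hk, ← lintegral_chainProd _ _ hk, ← volume_restrict_pi,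
    ← lintegral_indicator (MeasurableSet.univ_pi fun _ => measurableSet_Ioi)]
  · congr 1 with v
    have hm : (Fin.cons 0 v : Fin (l + 1) → ℝ) ∈ {u | IsStrictArgmin u 0} ↔
        v ∈ Set.univ.pi fun _ => Set.Ioi 0 := by
      simp only [Set.mem_ofPred_eq, IsStrictArgmin, Set.mem_univ_pi, Set.mem_Ioi]
      constructor
      · intro h i
        simpa using h i.succ (Fin.succ_ne_zero i)
      · intro h i hi
        obtain ⟨i, rfl⟩ := Fin.exists_succ_eq.2 hi
        simpa using h i
    by_cases hv : v ∈ Set.univ.pi fun _ => Set.Ioi (0 : ℝ)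
    · rw [Set.indicator_of_mem hv, Set.indicator_of_mem (hm.2 hv), cyclicProd_cons]
    · rw [Set.indicator_of_notMem hv, Set.indicator_of_notMem (hm.not.2 hv)]
  · exact hk.comp (measurable_fst.sub measurable_snd)

/-- Ties lie in finitely many proper subspaces, which are null; away from them the strict minimum
exists. -/
theorem ae_injective (l : ℕ) : ∀ᵐ v : Fin l → ℝ,
    Function.Injective (Fin.cons 0 v : Fin (l + 1) → ℝ) := by
  have h1 : ∀ᵐ v : Fin l → ℝ, ∀ i, v i ≠ 0 := by
    refine ae_all_iff.2 fun i => ?_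
    have := Measure.addHaar_submodule (volume : Measure (Fin l → ℝ))
      (LinearMap.ker (LinearMap.proj i : (Fin l → ℝ) →ₗ[ℝ] ℝ)) (by
        rw [Ne, LinearMap.ker_eq_top]
        intro h
        simpa using congrArg (fun f => f (Pi.single i 1)) h)
    rw [ae_iff]
    convert this using 2
    ext v
    simp
  have h2 : ∀ᵐ v : Fin l → ℝ, ∀ i j, i ≠ j → v i ≠ v j := by
    refine ae_all_iff.2 fun i => ae_all_iff.2 fun j => ?_
    by_cases hij : i = j
    · simp [hij]
    let D : (Fin l → ℝ) →ₗ[ℝ] ℝ :=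
      (LinearMap.proj i : (Fin l → ℝ) →ₗ[ℝ] ℝ) - (LinearMap.proj j : (Fin l → ℝ) →ₗ[ℝ] ℝ)
    have hD : ∀ v, D v = v i - v j := fun _ => rfl
    have := Measure.addHaar_submodule (volume : Measure (Fin l → ℝ)) (LinearMap.ker D) (by
        rw [Ne, LinearMap.ker_eq_top]
        intro h
        have := LinearMap.congr_fun h (Pi.single i 1)
        simp [hD, Ne.symm hij] at this)
    rw [ae_iff]
    convert this using 2
    ext v
    simp [hij, hD, sub_eq_zero]
  filter_upwards [h1, h2] with v h1 h2
  refine Fin.cons_injective_iff.2 ⟨?_, fun i j h => ?_⟩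
  · rintro ⟨i, hi⟩
    exact h1 i hi
  · by_contra hij
    exact h2 i j hij h

theorem sum_indicator_isStrictArgmin {l : ℕ} {u : Fin (l + 1) → ℝ} (hu : Function.Injective u)
    (G : (Fin (l + 1) → ℝ) → ℝ≥0∞) :
    ∑ j, {u | IsStrictArgmin u j}.indicator G u = G u := by
  obtain ⟨j, hj⟩ := Finite.exists_min u
  rw [Finset.sum_eq_single j]
  · refine Set.indicator_of_mem (fun i hi => ?_) _
    exact (hj i).lt_of_ne fun h => hi (hu h).symm
  · intro i _ hi
    refine Set.indicator_of_notMem (fun h => ?_) _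
    exact (h j hi.symm).not_ge (hj i)
  · simp

/-- The convolution power at `0` is a multiple of the half-line iterated integral: split according
to the position of the minimum in the cyclic product. -/
theorem chain_volume_eq {k : ℝ → ℝ≥0∞} (hk : Measurable k) (l : ℕ) :
    chain volume (fun x y => k (x - y)) k l 0 =
      (l + 1 : ℕ) * chain (volume.restrict (Set.Ioi 0)) (fun x y => k (x - y)) k l 0 := by
  have hk2 : Measurable (Function.uncurry fun x y : ℝ => k (x - y)) :=
    hk.comp (measurable_fst.sub measurable_snd)
  have hc := (measurable_finCons l).comp (measurable_const (a := (0 : ℝ)).prodMk measurable_id)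
  calc chain volume (fun x y => k (x - y)) k l 0
      = ∫⁻ v, cyclicProd k l (Fin.cons 0 v : Fin (l + 1) → ℝ) := by
        rw [← lintegral_chainProd _ hk2 hk, ← volume_pi]
        simp only [cyclicProd_cons]
    _ = ∫⁻ v, ∑ j, {u | IsStrictArgmin u j}.indicator (cyclicProd k l)
          (Fin.cons 0 v : Fin (l + 1) → ℝ) := by
        refine lintegral_congr_ae ?_
        filter_upwards [ae_injective l] with v hv
        rw [sum_indicator_isStrictArgmin hv]
    _ = ∑ j, ∫⁻ u in argminSet l j, cyclicProd k l u := by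
        rw [lintegral_finsetSum]
        · simp only [lintegral_argminSet hk]
        · intro j _
          exact ((measurable_cyclicProd hk l).indicator (measurableSet_isStrictArgmin j)).comp hc
    _ = _ := by
        simp only [lintegral_argminSet_rotate hk, lintegral_argminSet_zero hk]
        simp

/-! ### The Fourier transform of the sech kernel -/

theorem sigmoid_mul_one_sub_sigmoid (s : ℝ) :
    Real.sigmoid s * (1 - Real.sigmoid s) = sechKernel s ^ 2 := by
  have h : Real.exp s = Real.exp (s / 2) ^ 2 := by rw [← Real.exp_nat_mul]; congr 1; push_cast; ring
  have hp := Real.exp_pos (s / 2)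
  rw [Real.sigmoid_def, sechKernel, Real.cosh_eq, Real.exp_neg, Real.exp_neg, h]
  field_simp
  ring

theorem log_sigmoid (s : ℝ) : Real.log (Real.sigmoid s) = s / 2 + Real.log (sechKernel s) := by
  have hp := Real.exp_pos (s / 2)
  have h : Real.sigmoid s = Real.exp (s / 2) * sechKernel s := by
    have h : Real.exp s = Real.exp (s / 2) ^ 2 := by
      rw [← Real.exp_nat_mul]; congr 1; push_cast; ring
    rw [Real.sigmoid_def, sechKernel, Real.cosh_eq, Real.exp_neg, Real.exp_neg, h]
    field_simp
  rw [h, Real.log_mul hp.ne' (sechKernel_pos s).ne', Real.log_exp]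

/-- With σ = sigmoid s, the Jacobian is σ(1 - σ) = k², the exponents -1/2 contribute k⁻¹, and (σ/(1
- σ))^(it) = e^(its). So B(1/2 + it, 1/2 - it) is the Fourier transform of k. -/
theorem betaIntegrand_sigmoid (t s : ℝ) :
    |Real.sigmoid s * (1 - Real.sigmoid s)| •
        ((Real.sigmoid s : ℂ) ^ ((1 / 2 + t * Complex.I : ℂ) - 1) *
          (1 - (Real.sigmoid s : ℂ)) ^ ((1 / 2 - t * Complex.I : ℂ) - 1)) =
      (sechKernel s : ℂ) * Complex.exp (((t * s : ℝ) : ℂ) * Complex.I) := by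
  have hk := sechKernel_pos s
  have h1 : (Real.sigmoid s : ℂ) =
      Complex.exp ((s / 2 + Real.log (sechKernel s) : ℝ) : ℂ) := by
    rw [← log_sigmoid, ← Complex.ofReal_exp, Real.exp_log (Real.sigmoid_pos s)]
  have h2 : 1 - (Real.sigmoid s : ℂ) =
      Complex.exp ((-s / 2 + Real.log (sechKernel s) : ℝ) : ℂ) := by
    rw [← sechKernel_neg, ← log_sigmoid, ← Complex.ofReal_exp,
      Real.exp_log (Real.sigmoid_pos _), Real.sigmoid_neg]
    push_cast
    rfl
  have h3 : (sechKernel s : ℂ) = Complex.exp ((Real.log (sechKernel s) : ℝ) : ℂ) := by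
    rw [← Complex.ofReal_exp, Real.exp_log hk]
  have hp : ∀ (x : ℝ) (z : ℂ), Complex.exp (x : ℂ) ^ z = Complex.exp (x * z) := by
    intro x z
    rw [Complex.cpow_def_of_ne_zero (Complex.exp_ne_zero _), ← Complex.ofReal_exp,
      ← Complex.ofReal_log (Real.exp_pos x).le, Real.log_exp]
  rw [sigmoid_mul_one_sub_sigmoid, abs_of_pos (by positivity), h2, h1, hp, hp, Complex.real_smul,
    Complex.ofReal_pow, h3, ← Complex.exp_nat_mul, ← Complex.exp_add, ← Complex.exp_add,
    ← Complex.exp_add]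
  congr 1
  push_cast
  ring

theorem half_add_re (t : ℝ) : 0 < (1 / 2 + t * Complex.I : ℂ).re := by simp

theorem half_sub_re (t : ℝ) : 0 < (1 / 2 - t * Complex.I : ℂ).re := by simp

theorem integrable_sechKernel_mul_exp (t : ℝ) :
    Integrable fun s : ℝ => (sechKernel s : ℂ) * Complex.exp (((t * s : ℝ) : ℂ) * Complex.I) := by
  have h := Complex.betaIntegral_convergent (half_add_re t) (half_sub_re t)
  rw [intervalIntegrable_iff_integrableOn_Ioo_of_le zero_le_one, ← Real.range_sigmoid,
    ← Set.image_univ, integrableOn_image_iff_integrableOn_abs_deriv_smul MeasurableSet.univ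
      (fun x _ => (Real.hasDerivAt_sigmoid x).hasDerivWithinAt)
      Real.sigmoid_injective.injOn, integrableOn_univ] at h
  simpa only [betaIntegrand_sigmoid] using h

/-- Reflection formula: Γ(1/2 + it) Γ(1/2 - it) = π / sin(π/2 + πit) = π / cosh(πt). -/
theorem integral_sechKernel_mul_exp (t : ℝ) :
    ∫ s : ℝ, (sechKernel s : ℂ) * Complex.exp (((t * s : ℝ) : ℂ) * Complex.I) =
      ((2 * Real.pi * sechKernel (2 * Real.pi * t) : ℝ) : ℂ) := by
  have h := Complex.betaIntegral_eq_Gamma_mul_div _ _ (half_add_re t) (half_sub_re t)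
  have h1 : (1 / 2 - t * Complex.I : ℂ) = 1 - (1 / 2 + t * Complex.I) := by ring
  have hR : Complex.betaIntegral (1 / 2 + t * Complex.I) (1 / 2 - t * Complex.I) =
      ((2 * Real.pi * sechKernel (2 * Real.pi * t) : ℝ) : ℂ) := by
    rw [h, h1, Complex.Gamma_mul_Gamma_one_sub, add_sub_cancel, Complex.Gamma_one, div_one,
      mul_add, mul_one_div, add_comm, Complex.sin_add_pi_div_two, ← mul_assoc, Complex.cos_mul_I,
      sechKernel]
    push_cast
    have hc : Complex.cosh (Real.pi * t) ≠ 0 := by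
      rw [← Complex.ofReal_mul, ← Complex.ofReal_cosh]
      exact_mod_cast (Real.cosh_pos _).ne'
    rw [show (2 * Real.pi * t / 2 : ℂ) = Real.pi * t by ring]
    field_simp
  rw [← hR, Complex.betaIntegral, intervalIntegral.integral_of_le zero_le_one,
    integral_Ioc_eq_integral_Ioo, ← Real.range_sigmoid, ← Set.image_univ,
    integral_image_eq_integral_abs_deriv_smul MeasurableSet.univ
      (fun x _ => (Real.hasDerivAt_sigmoid x).hasDerivWithinAt) Real.sigmoid_injective.injOn,
    setIntegral_univ]
  simp only [betaIntegrand_sigmoid]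

theorem integrable_sechKernel : Integrable sechKernel := by
  have h := (integrable_sechKernel_mul_exp 0).re
  simpa using h

theorem sechKernel_le_half (s : ℝ) : sechKernel s ≤ 1 / 2 := by
  have := Real.one_le_cosh (s / 2)
  unfold sechKernel
  exact one_div_le_one_div_of_le two_pos (by linarith)

theorem integrable_sechKernel_pow (n : ℕ) : Integrable fun s => sechKernel s ^ (n + 1) := by
  refine (integrable_sechKernel.bdd_mul (c := 1)
    (continuous_sechKernel.pow n).aestronglyMeasurable (Filter.Eventually.of_forall fun s => ?_)).congr
    (Filter.Eventually.of_forall fun s => (pow_succ _ _).symm)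
  rw [Pi.pow_apply, Real.norm_of_nonneg (pow_nonneg (sechKernel_pos s).le n)]
  exact pow_le_one₀ (sechKernel_pos s).le ((sechKernel_le_half s).trans (by norm_num))

theorem integral_sechKernel_mul_cos (t : ℝ) :
    ∫ s, sechKernel s * Real.cos (t * s) = 2 * Real.pi * sechKernel (2 * Real.pi * t) := by
  have h := congrArg Complex.re (integral_sechKernel_mul_exp t)
  rw [← Complex.reCLM_apply, ← Complex.reCLM.integral_comp_comm (integrable_sechKernel_mul_exp t),
    Complex.ofReal_re] at h
  rw [← h]
  congr 1 with s
  rw [Complex.reCLM_apply, Complex.re_ofReal_mul, Complex.exp_ofReal_mul_I_re]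

theorem integral_sechKernel_mul_sin (t : ℝ) : ∫ s, sechKernel s * Real.sin (t * s) = 0 := by
  have h := congrArg Complex.im (integral_sechKernel_mul_exp t)
  rw [← Complex.imCLM_apply, ← Complex.imCLM.integral_comp_comm (integrable_sechKernel_mul_exp t),
    Complex.ofReal_im] at h
  rw [← h]
  congr 1 with s
  rw [Complex.imCLM_apply, Complex.im_ofReal_mul, Complex.exp_ofReal_mul_I_im]

/-- Cosines are eigenfunctions of convolution with k, because the sine integral vanishes. -/
theorem integral_sechKernel_sub_mul_cos (a t : ℝ) :
    ∫ b, sechKernel (a - b) * Real.cos (t * b) =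
      2 * Real.pi * sechKernel (2 * Real.pi * t) * Real.cos (t * a) := by
  have h1 : Integrable fun s => sechKernel s * Real.cos (t * s) :=
    integrable_sechKernel.mul_bdd (c := 1) (by fun_prop)
      (Filter.Eventually.of_forall fun s => Real.abs_cos_le_one _)
  have h2 : Integrable fun s => sechKernel s * Real.sin (t * s) :=
    integrable_sechKernel.mul_bdd (c := 1) (by fun_prop)
      (Filter.Eventually.of_forall fun s => Real.abs_sin_le_one _)
  rw [← integral_sub_left_eq_self _ volume a]
  calc _ = ∫ s, (sechKernel s * Real.cos (t * s) * Real.cos (t * a) +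
        sechKernel s * Real.sin (t * s) * Real.sin (t * a)) := by
        congr 1 with s
        rw [sub_sub_cancel, mul_sub, Real.cos_sub]
        ring
    _ = _ := by
        rw [integral_add (h1.mul_const _) (h2.mul_const _), integral_mul_const,
          integral_mul_const, integral_sechKernel_mul_cos, integral_sechKernel_mul_sin]
        ring

/-! ### Convolution powers of the sech kernel -/

/-- The Fourier representation of the `(l + 1)`-st convolution power of `sechKernel`. -/
noncomputable def sechFourier (l : ℕ) (a : ℝ) : ℝ :=
  1 / (4 * Real.pi ^ 2) *
    ∫ s, (2 * Real.pi * sechKernel s) ^ (l + 1) * Real.cos (s / (2 * Real.pi) * a)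

theorem integrable_two_pi_sechKernel_pow (l : ℕ) :
    Integrable fun s => (2 * Real.pi * sechKernel s) ^ (l + 1) := by
  simp only [mul_pow _ (sechKernel _)]
  exact (integrable_sechKernel_pow l).const_mul _

/-- Self-duality of k replaces Fourier inversion here. In 1/(4π²), one factor 1/(2π) is that of
inversion and the other comes from the frequency s/(2π). -/
theorem sechFourier_zero (a : ℝ) : sechFourier 0 a = sechKernel a := by
  have hpi := Real.pi_pos
  have h := integral_sechKernel_mul_cos (a / (2 * Real.pi))
  rw [mul_div_cancel₀ _ (by positivity)] at h
  unfold sechFourier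
  have e : ∀ s, (2 * Real.pi * sechKernel s) ^ (0 + 1) * Real.cos (s / (2 * Real.pi) * a) =
      2 * Real.pi * (sechKernel s * Real.cos (a / (2 * Real.pi) * s)) := by
    intro s
    rw [div_mul_eq_mul_div, div_mul_eq_mul_div, mul_comm s a]
    ring
  simp only [e]
  rw [integral_const_mul, h]
  field_simp
  norm_num

theorem integrable_prod_sechFourier (l : ℕ) (a : ℝ) :
    Integrable (Function.uncurry fun b s : ℝ => sechKernel (a - b) *
      ((2 * Real.pi * sechKernel s) ^ (l + 1) * Real.cos (s / (2 * Real.pi) * b)))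
      (volume.prod volume) := by
  have hc := continuous_sechKernel
  have h := (integrable_sechKernel.comp_sub_left a).mul_prod (integrable_two_pi_sechKernel_pow l)
  refine (h.mul_bdd (c := 1) (g := fun p : ℝ × ℝ => Real.cos (p.2 / (2 * Real.pi) * p.1))
    (Continuous.aestronglyMeasurable (by fun_prop))
    (Filter.Eventually.of_forall fun p => Real.abs_cos_le_one _)).congr
    (Filter.Eventually.of_forall fun p => ?_)
  simp only [Function.uncurry]
  ring

/-- By Fubini, convolution acts under the integral over s, where the cosine of frequency s/(2π) has
eigenvalue 2πk(s). -/
theorem sechFourier_succ (l : ℕ) (a : ℝ) :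
    sechFourier (l + 1) a = ∫ b, sechKernel (a - b) * sechFourier l b := by
  have hpi := Real.pi_pos
  have h := integral_integral_swap (integrable_prod_sechFourier l a)
  calc sechFourier (l + 1) a
      = 1 / (4 * Real.pi ^ 2) * ∫ s, ∫ b, sechKernel (a - b) *
      ((2 * Real.pi * sechKernel s) ^ (l + 1) * Real.cos (s / (2 * Real.pi) * b)) := by
        unfold sechFourier
        congr 2 with s
        have e : ∀ b, sechKernel (a - b) *
            ((2 * Real.pi * sechKernel s) ^ (l + 1) * Real.cos (s / (2 * Real.pi) * b)) =
            (2 * Real.pi * sechKernel s) ^ (l + 1) *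
              (sechKernel (a - b) * Real.cos (s / (2 * Real.pi) * b)) := fun b => by ring
        simp only [e]
        rw [integral_const_mul, integral_sechKernel_sub_mul_cos,
          mul_div_cancel₀ _ (by positivity : (2 * Real.pi) ≠ 0)]
        ring
    _ = ∫ b, sechKernel (a - b) * sechFourier l b := by
        rw [← h, ← integral_const_mul]
        congr 1 with b
        rw [integral_const_mul, sechFourier]
        ring

theorem integrable_sechKernel_mul_sechFourier (l : ℕ) (a : ℝ) :
    Integrable fun b => sechKernel (a - b) * sechFourier l b := by
  refine ((integrable_prod_sechFourier l a).integral_prod_left.const_mul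
    (1 / (4 * Real.pi ^ 2))).congr (Filter.Eventually.of_forall fun b => ?_)
  simp only [Function.uncurry, sechFourier]
  rw [integral_const_mul]
  ring

theorem sechFourier_nonneg (l : ℕ) (a : ℝ) : 0 ≤ sechFourier l a := by
  induction l generalizing a with
  | zero => rw [sechFourier_zero]; exact (sechKernel_pos a).le
  | succ l ih =>
    rw [sechFourier_succ]
    exact integral_nonneg fun b => mul_nonneg (sechKernel_pos _).le (ih b)

theorem chain_volume_eq_sechFourier (l : ℕ) (a : ℝ) :
    chain volume (fun x y => ENNReal.ofReal (sechKernel (x - y)))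
      (fun x => ENNReal.ofReal (sechKernel x)) l a = ENNReal.ofReal (sechFourier l a) := by
  induction l generalizing a with
  | zero => rw [chain, sechFourier_zero]
  | succ l ih =>
    rw [chain, sechFourier_succ, ofReal_integral_eq_lintegral_ofReal
      (integrable_sechKernel_mul_sechFourier l a) (Filter.Eventually.of_forall fun b =>
        mul_nonneg (sechKernel_pos _).le (sechFourier_nonneg l b))]
    congr 1 with b
    rw [ih, ENNReal.ofReal_mul (sechKernel_pos _).le]

/-! ### Recursion for the integrals of powers of the kernel -/

/-- From k' = -sinh(s/2) k², cosh(s/2) k = 1/2 and sinh² = cosh² - 1. Since the integral of this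
derivative is zero, the powers n + 3 and n + 1 are linked. -/
theorem hasDerivAt_sinh_mul_sechKernel_pow (n : ℕ) (s : ℝ) :
    HasDerivAt (fun s => Real.sinh (s / 2) * sechKernel s ^ (n + 2))
      ((n + 2) * sechKernel s ^ (n + 3) - (n + 1) / 4 * sechKernel s ^ (n + 1)) s := by
  have hc := Real.cosh_pos (s / 2)
  have h1 : HasDerivAt (fun s : ℝ => s / 2) (1 / 2) s := (hasDerivAt_id s).div_const 2
  have hk : HasDerivAt sechKernel (-(Real.sinh (s / 2) * sechKernel s ^ 2)) s := by
    have h := (h1.cosh.const_mul 2).inv (by positivity)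
    have e : sechKernel = (fun s : ℝ => 2 * Real.cosh (s / 2))⁻¹ := by
      ext s; simp only [sechKernel, one_div, Pi.inv_apply]
    rw [e]
    refine h.congr_deriv ?_
    simp only [Pi.inv_apply]
    field_simp
  refine (h1.sinh.mul (hk.pow (n + 2))).congr_deriv ?_
  have hs := Real.sinh_sq (s / 2)
  have hck : Real.cosh (s / 2) * sechKernel s = 1 / 2 := by
    unfold sechKernel
    field_simp
  simp only [Nat.add_succ_sub_one, Pi.pow_apply]
  generalize sechKernel s = k at *
  push_cast
  linear_combination k ^ (n + 1) / 2 * hck - (n + 2) * k ^ (n + 3) * hs -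
    (n + 2) * k ^ (n + 1) * (Real.cosh (s / 2) * k + 1 / 2) * hck

theorem integral_sechKernel_pow_add_two (n : ℕ) :
    4 * (n + 2) * ∫ s, sechKernel s ^ (n + 3) = (n + 1) * ∫ s, sechKernel s ^ (n + 1) := by
  have hi : Integrable fun s => Real.sinh (s / 2) * sechKernel s ^ (n + 2) := by
    refine (integrable_sechKernel_pow n).mono' (Continuous.aestronglyMeasurable ?_)
      (Filter.Eventually.of_forall fun s => ?_)
    · have := continuous_sechKernel
      fun_prop
    · have hk := sechKernel_pos s
      have hc := Real.cosh_pos (s / 2)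
      have h1 : |Real.sinh (s / 2)| ≤ Real.cosh (s / 2) :=
        abs_le_of_sq_le_sq (by linarith [Real.cosh_sq (s / 2)]) hc.le
      have h2 : Real.cosh (s / 2) * sechKernel s ≤ 1 := by
        unfold sechKernel
        field_simp
        norm_num
      rw [norm_mul, Real.norm_eq_abs, Real.norm_of_nonneg (by positivity), pow_succ' _ (n + 1),
        ← mul_assoc]
      refine mul_le_of_le_one_left (by positivity) (le_trans ?_ h2)
      gcongr
  have h1 := (integrable_sechKernel_pow (n + 2)).const_mul ((n : ℝ) + 2)
  have h2 := (integrable_sechKernel_pow n).const_mul (((n : ℝ) + 1) / 4)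
  have h := integral_eq_zero_of_hasDerivAt_of_integrable (hasDerivAt_sinh_mul_sechKernel_pow n)
    (h1.sub h2) hi
  rw [integral_sub h1 h2, integral_const_mul, integral_const_mul] at h
  linear_combination 4 * h

theorem integral_sechKernel_sq : ∫ s, sechKernel s ^ 2 = 1 := by
  have h := integral_of_hasDerivAt_of_tendsto (f := Real.sigmoid) (fun x => by
      have := Real.hasDerivAt_sigmoid x
      rwa [sigmoid_mul_one_sub_sigmoid] at this) (integrable_sechKernel_pow 1)
    Real.tendsto_sigmoid_atBot Real.tendsto_sigmoid_atTop
  simpa using h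

theorem sechFourier_at_zero (l : ℕ) :
    sechFourier l 0 = (2 * Real.pi) ^ (l + 1) / (4 * Real.pi ^ 2) * ∫ s, sechKernel s ^ (l + 1) := by
  simp only [sechFourier, mul_zero, Real.cos_zero, mul_one, mul_pow _ (sechKernel _)]
  rw [integral_const_mul]
  ring

theorem sechFourier_zero_zero : sechFourier 0 0 = 1 / 2 := by
  simp [sechFourier_zero, sechKernel]

theorem sechFourier_one_zero : sechFourier 1 0 = 1 := by
  have := Real.pi_pos
  rw [sechFourier_at_zero, integral_sechKernel_sq]
  field_simp
  ring

theorem sechFourier_add_two (l : ℕ) :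
    (l + 2) * sechFourier (l + 2) 0 = Real.pi ^ 2 * (l + 1) * sechFourier l 0 := by
  have hpi := Real.pi_pos
  rw [sechFourier_at_zero, sechFourier_at_zero]
  have h := integral_sechKernel_pow_add_two l
  field_simp
  rw [show l + 2 + 1 = l + 3 by ring]
  linear_combination Real.pi ^ 2 * (2 * Real.pi) ^ (l + 1) * h

/-! ### Evaluation of ξ_l and absolute convergence -/

theorem lintegral_xiIntegrand_eq (l : ℕ) :
    ∫⁻ x in unitCube l, ENNReal.ofReal (xiIntegrand l x) =
      ENNReal.ofReal (2 * sechFourier l 0 / (l + 1)) := by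
  have h := chain_volume_eq (k := fun x => ENNReal.ofReal (sechKernel x))
    continuous_sechKernel.measurable.ennreal_ofReal l
  rw [chain_volume_eq_sechFourier] at h
  have hl : ((l + 1 : ℕ) : ℝ≥0∞) ≠ 0 := by simp
  rw [lintegral_xiIntegrand_eq_chain_sech, mul_div_assoc, ENNReal.ofReal_mul zero_le_two,
    ENNReal.ofReal_div_of_pos (by positivity), h, ENNReal.ofReal_ofNat]
  congr 1
  rw [show (l + 1 : ℝ) = ((l + 1 : ℕ) : ℝ) by push_cast; rfl, ENNReal.ofReal_natCast,
    mul_comm, ENNReal.mul_div_cancel_right hl (ENNReal.natCast_ne_top _)]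

theorem integrableOn_xiIntegrand (l : ℕ) : IntegrableOn (xiIntegrand l) (unitCube l) := by
  refine ⟨(measurable_xiIntegrand l).aestronglyMeasurable, ?_⟩
  rw [hasFiniteIntegral_iff_ofReal (ae_restrict_of_forall_mem (measurableSet_unitCube l)
    fun x hx => xiIntegrand_nonneg l hx), lintegral_xiIntegrand_eq]
  exact ENNReal.ofReal_lt_top

theorem xi_eq_sechFourier (l : ℕ) : xi l = 2 * sechFourier l 0 / (l + 1) := by
  rw [xi, integral_eq_lintegral_of_nonneg_ae (ae_restrict_of_forall_mem (measurableSet_unitCube l)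
    fun x hx => xiIntegrand_nonneg l hx) (measurable_xiIntegrand l).aestronglyMeasurable,
    lintegral_xiIntegrand_eq, ENNReal.toReal_ofReal]
  have := sechFourier_nonneg l 0
  positivity

/-! ### The square of the arcsine series and the convolution identity -/

open PowerSeries in
/-- The coefficients satisfy the differential equations of `arcsin x / x`, `1 / √(1 - x²)` and their
product, in the variable `x²`. -/
theorem antidiagonal_sum_arcsin (α β : ℕ → ℝ) (hβ0 : β 0 = 1)
    (hα : ∀ n, (2 * n + 1) * α n = β n)
    (hβ : ∀ n, (2 * n + 2) * β (n + 1) = (2 * n + 1) * β n) (m : ℕ) :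
    (2 * m + 3) * ((m + 2) * ∑ p ∈ Finset.HasAntidiagonal.antidiagonal (m + 1), α p.1 * α p.2) =
      (2 * m + 2) * ((m + 1) * ∑ p ∈ Finset.HasAntidiagonal.antidiagonal m, α p.1 * α p.2) := by
  set A : PowerSeries ℝ := mk α
  set B : PowerSeries ℝ := mk β
  have hAB : 2 * X * d⁄dX ℝ A + A = B := by
    ext n
    cases n with
    | zero => simp [A, B, mul_assoc, ← hα]
    | succ n =>
      have := hα (n + 1)
      simp only [A, B, mul_assoc, ← map_ofNat (C (R := ℝ)), map_add, coeff_C_mul,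
        coeff_succ_X_mul, coeff_derivative, coeff_mk, ← this]
      push_cast
      ring
  have hBd : 2 * (d⁄dX ℝ B - X * d⁄dX ℝ B) = B := by
    ext n
    cases n with
    | zero =>
      have := hβ 0
      simp only [B, ← map_ofNat (C (R := ℝ)), map_sub, coeff_C_mul, coeff_zero_X_mul,
        coeff_derivative, coeff_mk]
      push_cast at this ⊢
      linear_combination this
    | succ n =>
      have := hβ (n + 1)
      simp only [B, ← map_ofNat (C (R := ℝ)), map_sub, coeff_C_mul, coeff_succ_X_mul,
        coeff_derivative, coeff_mk]
      push_cast at this ⊢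
      linear_combination this
  -- The derivative vanishes by `hBd`, and the constant term is 1.
  have hBB : (1 - X) * B ^ 2 = 1 := by
    refine derivative.ext ?_ ?_
    · simp only [Derivation.leibniz, Derivation.leibniz_pow, map_sub, smul_eq_mul, derivative_X,
        Derivation.map_one_eq_zero, nsmul_eq_mul]
      push_cast
      linear_combination B * hBd
    · simp [B, hβ0]
  have hq : 2 * (X * d⁄dX ℝ (A * B)) - 2 * (X * (X * d⁄dX ℝ (A * B))) =
      1 + 2 * (X * (A * B)) - A * B := by
    simp only [Derivation.leibniz, smul_eq_mul]
    linear_combination (1 - X) * B * hAB + X * A * hBd + hBB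
  -- This is the derivative of arcsin² in the variable x²; it turns the coefficients of A² into
  -- those of A B, which satisfies the first-order equation `hq`.
  have hP : d⁄dX ℝ (X * (A * A)) = A * B := by
    simp only [Derivation.leibniz, smul_eq_mul, derivative_X]
    linear_combination A * hAB
  have hS : ∀ n, coeff n (A * B) =
      (n + 1) * ∑ p ∈ Finset.HasAntidiagonal.antidiagonal n, α p.1 * α p.2 := by
    intro n
    rw [← hP, coeff_derivative, coeff_succ_X_mul, coeff_mul]
    simp only [A, coeff_mk]
    ring
  have h := congrArg (coeff (m + 1)) hq
  simp only [← map_ofNat (C (R := ℝ)), map_sub, map_add, coeff_C_mul, coeff_succ_X_mul] at h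
  have hX : coeff m (X * d⁄dX ℝ (A * B)) = m * coeff m (A * B) := by
    cases m with
    | zero => simp
    | succ m => rw [coeff_succ_X_mul, coeff_derivative]; push_cast; ring
  rw [hX, coeff_derivative, coeff_one, if_neg (Nat.succ_ne_zero m), hS, hS] at h
  push_cast at h
  linear_combination h

theorem sum_xi_even (m : ℕ) :
    ∑ p ∈ Finset.HasAntidiagonal.antidiagonal m, xi (2 * p.1) * xi (2 * p.2) =
      xi (2 * m + 1) := by
  have hpi := Real.pi_pos.ne'
  set α : ℕ → ℝ := fun h => xi (2 * h) / Real.pi ^ (2 * h) with hα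
  have hstep := antidiagonal_sum_arcsin α
    (fun h => 2 * sechFourier (2 * h) 0 / Real.pi ^ (2 * h))
    (by simp [sechFourier_zero_zero])
    (fun n => by
      simp only [hα, xi_eq_sechFourier]
      push_cast
      field_simp)
    (fun n => by
      have h := sechFourier_add_two (2 * n)
      push_cast at h
      rw [show 2 * (n + 1) = 2 * n + 2 by ring, pow_add]
      field_simp
      linear_combination h)
  -- Both sides satisfy the same first-order recursion, `hstep` on the left and
  -- `sechFourier_add_two` at odd index on the right, and both equal 1 at m = 0.
  have key : ∀ m : ℕ, (m + 1) * ∑ p ∈ Finset.HasAntidiagonal.antidiagonal m, α p.1 * α p.2 =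
      sechFourier (2 * m + 1) 0 / Real.pi ^ (2 * m) := by
    intro m
    induction m with
    | zero => simp [hα, xi_eq_sechFourier, sechFourier_zero_zero, sechFourier_one_zero]
    | succ m ih =>
      have h := sechFourier_add_two (2 * m + 1)
      have h' := hstep m
      rw [ih] at h'
      push_cast at h ⊢
      have h3 : (2 * m + 3 : ℝ) ≠ 0 := by positivity
      rw [show (m + 1 + 1 : ℝ) = m + 2 by ring]
      refine mul_left_cancel₀ h3 (h'.trans ?_)
      rw [show 2 * (m + 1) + 1 = 2 * m + 1 + 2 by ring, show 2 * (m + 1) = 2 * m + 2 by ring,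
        pow_add]
      field_simp
      linear_combination -h
  have hsum : ∑ p ∈ Finset.HasAntidiagonal.antidiagonal m, xi (2 * p.1) * xi (2 * p.2) =
      Real.pi ^ (2 * m) * ∑ p ∈ Finset.HasAntidiagonal.antidiagonal m, α p.1 * α p.2 := by
    rw [Finset.mul_sum]
    refine Finset.sum_congr rfl fun p hp => ?_
    have hp : p.1 + p.2 = m := by simpa using hp
    rw [← hp, mul_add, pow_add]
    simp only [hα]
    field_simp
  have hm : (m + 1 : ℝ) ≠ 0 := by positivity
  refine mul_left_cancel₀ hm ?_
  rw [hsum, mul_left_comm, key, xi_eq_sechFourier]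
  push_cast
  field_simp
  ring

theorem mainTheorem2 (l m : ℕ) (hl : l = 2 * m) :
    (∀ k ≤ l + 1, IntegrableOn (xiIntegrand k) (unitCube k)) ∧
      xi (l + 1) = ∑ h ∈ Finset.range (m + 1), xi (2 * h) * xi (l - 2 * h) := by
  refine ⟨fun k _ => integrableOn_xiIntegrand k, ?_⟩
  rw [hl, ← sum_xi_even, Finset.Nat.sum_antidiagonal_eq_sum_range_succ_mk]
  simp only [Nat.mul_sub]
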